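/- Let $m\ge 1$. For $\mathbf s,\mathbf t\in\mathbb Z^m$ put $d(\mathbf s,\mathbf t)=\max_{i\le m}|s_i-t_i|$. For each integer $n\ge 1$ let $X_n=(X_n(\mathbf t))_{\mathbf t\in\mathbb Z^m}$ be a random field with values in $\{0,1\}$ that is stationary (its law is invariant under all shifts of $\mathbb Z^m$) and Markov: for every finite $I\subset\mathbb Z^m$, $$\mathcal L\bigl(X_n(I)\,\big|\,X_n(\mathbb Z^m\setminus I)\bigr)=\mathcal L\bigl(X_n(I)\,\big|\,X_n(\partial I)\bigr),\qquad \partial I=\{\mathbf s: d(\mathbf s,I)=1\},$$ where $X_n(I)=(X_n(\mathbf t))_{\mathbf t\in I}$. For $t>0$ let $$\Psi_n(t)=\sup|\mathbb P(B\mid A)-\mathbb P(B)|,$$ the supremum being over all sites $\mathbf s\in\mathbb Z^m$, all sets $G\subset\mathbb Z^m$ with $d(\mathbf s,\mathbf u)\ge t$ for all $\mathbf u\in G$, all $A\in\sigma(X_n(\mathbf s))$ with $\mathbb P(A)>0$, and all $B\in\sigma(X_n(\mathbf u):\mathbf u\in G)$. For an integer $b>0$ let $\xi_n^b(t)$ be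 the same supremum with $A$ now ranging over the events of positive probability in $\sigma\bigl(X_n(\mathbf s),\sum_{d(\mathbf u,\mathbf s)\le b}X_n(\mathbf u)\bigr)$. Suppose that: (i) there is $c>0$ such that $(2n+1)^m\,\mathbb E[X_n(0)]\le c$ for all $n\ge 1$; (ii) for all integers $b>0$ and $k\ge 1$ the limit $$\lambda^b(k):=\lim_{n\to\infty}\frac{(2n+1)^m}{k}\,\mathbb P\Bigl(X_n(0)=1\ \text{and}\ \sum_{\mathbf t\in\{-b,\dots,b\}^m}X_n(\mathbf t)=k\Bigr)$$ exists; (iii) there are constants $c_1\in\mathbb R$ and $c_2>0$ such that, for all $n\ge 1$, $\Psi_n(t)\le c_1e^{-c_2t}$ for all real $t>0$, and $\xi_n^b(t)\le c_1e^{-c_2t}$ for all integers $b>0$ and all real $t\ge 2b$. Then the limit $\lambda(k):=\lim_{b\to\infty}\lambda^b(k)$ exists in $[0,\infty)$ for every $k\ge 1$, $\sum_{k\ge 1}\lambda(k)<\infty$, and $$\sup_{A\subset\{0,1,2,\dots\}}\Bigl|\mathbb P\Bigl(\sum_{\mathbf t\in\{-n,\dots,n\}^m}X_n(\mathbf t)\in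 A\Bigr)-\mathbb P\bigl(Z(\lambda)\in A\bigr)\Bigr|\longrightarrow 0\qquad(n\to\infty),$$ where $Z(\lambda)$ is compound Poisson: $Z(\lambda)$ has the law of $\sum_{i\le N}M_i$, with $N\sim\mathrm{Poisson}\bigl(\sum_k\lambda(k)\bigr)$ and $M_1,M_2,\dots$ i.i.d., independent of $N$, with $\mathbb P(M_i=k)=\lambda(k)/\sum_j\lambda(j)$ for $k\ge 1$ (and $Z(\lambda)=0$ if $\lambda=0$). -/

import Mathlib

open MeasureTheory ProbabilityTheory Filter Topology
open scoped NNReal ENNReal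

namespace BinaryField

variable {m : ℕ} {Ω : Type*}

/-- The discrete box of radius `b` around `t`, i.e. the closed ball of the metric
`d(s, t) = max_i |s_i - t_i|` on `ℤ^m`. (Mathlib's `dist` on `Fin m → ℤ` is this metric.) -/
noncomputable def box (b : ℕ) (t : Fin m → ℤ) : Finset (Fin m → ℤ) :=
  Fintype.piFinset fun i => Finset.Icc (t i - (b : ℤ)) (t i + (b : ℤ))

/-- The sum of a binary field over the box of radius `b` around `t`. -/
noncomputable def boxSum (X : Ω → (Fin m → ℤ) → Fin 2) (b : ℕ) (t : Fin m → ℤ) (ω : Ω) : ℕ :=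
  ∑ s ∈ box b t, (X ω s : ℕ)

/-- The σ-algebra `σ(X(t) : t ∈ G)`. -/
abbrev sigmaOn (X : Ω → (Fin m → ℤ) → Fin 2) (G : Set (Fin m → ℤ)) : MeasurableSpace Ω :=
  ⨆ t ∈ G, MeasurableSpace.comap (fun ω => X ω t) inferInstance

/-- The σ-algebra generated by the pair `(X(t), ∑_{s ∈ B_b(t)} X(s))`. -/
noncomputable abbrev sigmaBox (X : Ω → (Fin m → ℤ) → Fin 2) (b : ℕ) (t : Fin m → ℤ) : MeasurableSpace Ω :=
  MeasurableSpace.comap (fun ω => (X ω t, boxSum X b t ω)) inferInstance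

/-- The law of the field is invariant under all shifts of `ℤ^m`. -/
def IsStationary [MeasurableSpace Ω] (P : Measure Ω) (X : Ω → (Fin m → ℤ) → Fin 2) : Prop :=
  ∀ s : Fin m → ℤ, P.map (fun ω t => X ω (t + s)) = P.map X

/-- The boundary `∂I`: the sites at distance exactly `1` from `I`. -/
def boundary (I : Set (Fin m → ℤ)) : Set (Fin m → ℤ) :=
  {s | Metric.infDist s I = 1}

/-- Markov property: for every finite `I`, the conditional law of `X(I)` given the field outside
`I` is its conditional law given the field on `∂I`. -/
def IsMarkov [MeasurableSpace Ω] (P : Measure Ω) (X : Ω → (Fin m → ℤ) → Fin 2) : Prop :=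
  ∀ I : Finset (Fin m → ℤ), ∀ E : Set Ω, MeasurableSet[sigmaOn X (I : Set (Fin m → ℤ))] E →
    P⟦E | sigmaOn X (I : Set (Fin m → ℤ))ᶜ⟧
      =ᵐ[P] P⟦E | sigmaOn X (boundary (I : Set (Fin m → ℤ)))⟧

/-- The mixing coefficient `Ψ(t) = sup |P(B|A) - P(B)|` over all `A ∈ σ(X(s))` with `P(A) > 0`
and `B ∈ σ(X(G))`, where `s` is a site and `G` is a set of sites at distance at least `t`
from `s`. The supremum is over a nonempty subset of `[0, 1]`. -/
noncomputable def mixPsi [MeasurableSpace Ω] (P : Measure Ω) (X : Ω → (Fin m → ℤ) → Fin 2)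
    (t : ℝ) : ℝ :=
  sSup {r : ℝ | ∃ (s : Fin m → ℤ) (G : Set (Fin m → ℤ)) (A B : Set Ω),
    (∀ u ∈ G, t ≤ dist s u) ∧ MeasurableSet[sigmaOn X {s}] A ∧ MeasurableSet[sigmaOn X G] B ∧
      P A ≠ 0 ∧ r = |(cond P A).real B - P.real B|}

/-- The mixing coefficient `ξ^b(t)`: as `Ψ(t)`, but with `A` in the σ-algebra generated by `X(s)`
and the sum of the field over the box of radius `b` around `s`. -/
noncomputable def mixXi [MeasurableSpace Ω] (P : Measure Ω) (X : Ω → (Fin m → ℤ) → Fin 2)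
    (b : ℕ) (t : ℝ) : ℝ :=
  sSup {r : ℝ | ∃ (s : Fin m → ℤ) (G : Set (Fin m → ℤ)) (A B : Set Ω),
    (∀ u ∈ G, t ≤ dist s u) ∧ MeasurableSet[sigmaBox X b s] A ∧ MeasurableSet[sigmaOn X G] B ∧
      P A ≠ 0 ∧ r = |(cond P A).real B - P.real B|}

open scoped Classical in
/-- The jump law `P(M = k) = l(k) / ∑_j l(j)` for `k ≥ 1`, as a law on `ℕ`. The second branch is
never used when `l` is summable and nonzero. -/
noncomputable def jumpLaw (l : ℕ+ → ℝ≥0) : PMF ℕ :=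
  if h : (∑' k, (l k : ℝ≥0∞)) ≠ 0 ∧ (∑' k, (l k : ℝ≥0∞)) ≠ ∞ then
    (PMF.normalize (fun k => (l k : ℝ≥0∞)) h.1 h.2).map (fun k : ℕ+ => (k : ℕ))
  else PMF.pure 1

/-- The law of `∑_{i ≤ N} M_i` with `N ∼ Poisson(∑_k l(k))`, and `M_1, M_2, …` i.i.d. with law
`jumpLaw l` and independent of `N`. If `l = 0`, then `N = 0` almost surely and this is the point
mass at `0`. -/
noncomputable def compoundPoisson (l : ℕ+ → ℝ≥0) : Measure ℕ :=
  ((poissonMeasure (∑' k, l k)).prod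
    (Measure.infinitePi fun _ : ℕ => (jumpLaw l).toMeasure)).map
      (fun p : ℕ × (ℕ → ℕ) => ∑ i ∈ Finset.range p.1, p.2 i)

/-- Total variation distance `sup_A |μ(A) - ν(A)|` of two laws on `ℕ`. -/
noncomputable def tvDist (μ ν : Measure ℕ) : ℝ :=
  ⨆ A : Set ℕ, |μ.real A - ν.real A|

end BinaryField

/-! Let `S` be the number of ones in the box of radius `n`, `N = (2n+1)^m` and `p = P(X(0) = 1)`, so
that `N p ≤ c`. Counting ones gives `r P(S = r) = ∑_t P(X(t) = 1, S = r)`. For `t` away from the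
edge of the box, ones near `t` form a cluster. With high enough probability the annulus between
radii `b` and `2b` is empty, so `S` is the cluster size `k` plus a far sum. The far sum is almost
independent of the cluster by the bound on `ξ^b(2b)`, and it has nearly the law of `S`. Hence,
letting `n → ∞` and then `b → ∞`, `r P(S = r) ≈ ∑_{k=1}^r k λ(k) P(S = r - k)`, which is Panjer's
recursion for the compound Poisson law.

The recursion fixes the point probabilities up to the value at `0`. Markov's inequality makes the
laws of `S` tight, so the total mass `1` fixes that value too. Pointwise convergence on `ℕ` to a
probability law then gives convergence in total variation.

The limits `λ(k)` exist because passing from radius `b` to `b + 1` matters only if there is a one in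
the new shell, which costs a summable amount in `b`. The main lemmas are `abs_site_sub_le`,
`abs_recursion_le`, `compoundPoisson_recursion` and `tendsto_of_recursion`. -/

namespace BinaryField

/-! ### Boxes, generated σ-algebras and stationarity -/

section Field

variable {m : ℕ} {Ω : Type*}

lemma mem_box {b : ℕ} {s t : Fin m → ℤ} : s ∈ box b t ↔ dist s t ≤ b := by
  rw [dist_pi_le_iff (by positivity)]
  simp only [box, Fintype.mem_piFinset, Finset.mem_Icc, Int.dist_eq]
  refine forall_congr' fun i => ?_
  rw [abs_le]
  constructor
  · rintro ⟨h1, h2⟩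
    constructor
    · have : ((t i - b : ℤ) : ℝ) ≤ s i := by exact_mod_cast h1
      push_cast at this; linarith
    · have : ((s i : ℤ) : ℝ) ≤ (t i + b : ℤ) := by exact_mod_cast h2
      push_cast at this; linarith
  · rintro ⟨h1, h2⟩
    constructor
    · have : ((t i - b : ℤ) : ℝ) ≤ s i := by push_cast; linarith
      exact_mod_cast this
    · have : ((s i : ℤ) : ℝ) ≤ (t i + b : ℤ) := by push_cast; linarith
      exact_mod_cast this

lemma self_mem_box (b : ℕ) (t : Fin m → ℤ) : t ∈ box b t := by
  simp [mem_box]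

lemma box_mono {a b : ℕ} (h : a ≤ b) (t : Fin m → ℤ) : box a t ⊆ box b t := by
  intro s hs
  rw [mem_box] at *
  exact hs.trans (by exact_mod_cast h)

lemma box_subset_box {a b : ℕ} {s t : Fin m → ℤ} (hs : s ∈ box a t) :
    box b s ⊆ box (a + b) t := by
  intro u hu
  rw [mem_box] at *
  have := dist_triangle u s t
  push_cast
  linarith

lemma card_box (b : ℕ) (t : Fin m → ℤ) : (box b t).card = (2 * b + 1) ^ m := by
  simp only [box, Fintype.card_piFinset, Int.card_Icc]
  rw [Finset.prod_eq_pow_card (b := 2 * b + 1)]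
  · simp
  · intro i _
    omega

lemma boxSum_shift (X : Ω → (Fin m → ℤ) → Fin 2) (b : ℕ) (t : Fin m → ℤ) (ω : Ω) :
    boxSum X b t ω = ∑ s ∈ box b 0, (X ω (s + t) : ℕ) := by
  unfold boxSum
  symm
  refine Finset.sum_bij (fun s _ => s + t) ?_ ?_ ?_ ?_
  · intro s hs
    simpa [mem_box, dist_eq_norm] using hs
  · intro s _ s' _ h
    exact add_right_cancel h
  · intro s hs
    exact ⟨s - t, by simpa [mem_box, dist_eq_norm] using hs, by simp⟩
  · intros; rfl

lemma measurable_sigmaOn_siteSum {G : Set (Fin m → ℤ)} {W : Finset (Fin m → ℤ)}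
    (hW : ∀ u ∈ W, u ∈ G) :
    Measurable[sigmaOn X G] fun ω => ∑ s ∈ W, (X ω s : ℕ) := by
  refine @Finset.measurable_sum _ _ _ _ _ _ (sigmaOn X G) _ _ fun s hs => ?_
  refine (measurable_of_countable (fun x : Fin 2 => (x : ℕ))).comp ?_
  refine Measurable.mono (comap_measurable (fun ω => X ω s)) ?_ le_rfl
  exact le_iSup₂ (f := fun t (_ : t ∈ G) =>
    MeasurableSpace.comap (fun ω => X ω t) inferInstance) s (hW s hs)

lemma measurableSet_sigmaOn_site {G : Set (Fin m → ℤ)} {u : Fin m → ℤ} (hu : u ∈ G) :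
    MeasurableSet[sigmaOn X G] {ω | X ω u = 1} := by
  have h : Measurable[sigmaOn X G] fun ω => X ω u :=
    Measurable.mono (comap_measurable (fun ω => X ω u))
      (le_iSup₂ (f := fun t (_ : t ∈ G) =>
        MeasurableSpace.comap (fun ω => X ω t) inferInstance) u hu) le_rfl
  exact h (measurableSet_singleton (1 : Fin 2))

lemma measurableSet_sigmaBox (b : ℕ) (t : Fin m → ℤ) (k : ℕ) :
    MeasurableSet[sigmaBox X b t] {ω | X ω t = 1 ∧ boxSum X b t ω = k} :=
  ⟨{(1, k)}, measurableSet_singleton _, by ext ω; simp⟩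

variable [MeasurableSpace Ω] {P : Measure Ω} {X : Ω → (Fin m → ℤ) → Fin 2}

lemma measurable_siteSum (hX : Measurable X) (W : Finset (Fin m → ℤ)) :
    Measurable fun ω => ∑ s ∈ W, (X ω s : ℕ) := by
  refine Finset.measurable_sum _ fun s _ => ?_
  exact (measurable_of_countable (fun x : Fin 2 => (x : ℕ))).comp ((measurable_pi_apply s).comp hX)

lemma measurable_boxSum (hX : Measurable X) (b : ℕ) (t : Fin m → ℤ) : Measurable (boxSum X b t) :=
  measurable_siteSum hX _

lemma measurableSet_site (hX : Measurable X) (t : Fin m → ℤ) : MeasurableSet {ω | X ω t = 1} :=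
  ((measurable_pi_apply t).comp hX) (measurableSet_singleton (1 : Fin 2))

lemma sigmaOn_le (hX : Measurable X) (G : Set (Fin m → ℤ)) :
    sigmaOn X G ≤ (inferInstance : MeasurableSpace Ω) :=
  iSup₂_le fun t _ => ((measurable_pi_apply t).comp hX).comap_le

lemma sigmaBox_le (hX : Measurable X) (b : ℕ) (t : Fin m → ℤ) :
    sigmaBox X b t ≤ (inferInstance : MeasurableSpace Ω) :=
  (((measurable_pi_apply t).comp hX).prodMk (measurable_boxSum hX b t)).comap_le

lemma mixPsi_nonneg (t : ℝ) : 0 ≤ mixPsi P X t := by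
  refine Real.sSup_nonneg ?_
  rintro r ⟨s, G, A, B, -, -, -, -, rfl⟩
  exact abs_nonneg _

lemma mixXi_nonneg (b : ℕ) (t : ℝ) : 0 ≤ mixXi P X b t := by
  refine Real.sSup_nonneg ?_
  rintro r ⟨s, G, A, B, -, -, -, -, rfl⟩
  exact abs_nonneg _

lemma IsStationary.real_preimage_shift (hs : IsStationary P X) (hX : Measurable X)
    {E : Set ((Fin m → ℤ) → Fin 2)} (hE : MeasurableSet E) (t : Fin m → ℤ) :
    P.real {ω | (fun s => X ω (s + t)) ∈ E} = P.real {ω | X ω ∈ E} := by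
  have h := congrArg (fun μ : Measure ((Fin m → ℤ) → Fin 2) => μ.real E) (hs t)
  rw [map_measureReal_apply, map_measureReal_apply hX hE] at h
  · exact h
  · exact measurable_pi_lambda _ fun s => (measurable_pi_apply (s + t)).comp hX
  · exact hE

lemma IsStationary.real_site (hs : IsStationary P X) (hX : Measurable X) (t : Fin m → ℤ) :
    P.real {ω | X ω t = 1} = P.real {ω | X ω 0 = 1} := by
  have h := hs.real_preimage_shift hX 
    (measurableSet_site (X := fun x : (Fin m → ℤ) → Fin 2 => x) measurable_id 0) t
  simpa using h

lemma IsStationary.real_site_boxSum (hs : IsStationary P X) (hX : Measurable X) (b k : ℕ)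
    (t : Fin m → ℤ) :
    P.real {ω | X ω t = 1 ∧ boxSum X b t ω = k} = P.real {ω | X ω 0 = 1 ∧ boxSum X b 0 ω = k} := by
  have hE : MeasurableSet
      {x : (Fin m → ℤ) → Fin 2 | x 0 = 1 ∧ ∑ s ∈ box b (0 : Fin m → ℤ), (x s : ℕ) = k} := by
    refine (measurableSet_site (X := fun x : (Fin m → ℤ) → Fin 2 => x) measurable_id 0).inter ?_
    exact measurable_siteSum (X := fun x : (Fin m → ℤ) → Fin 2 => x) measurable_id (box b 0)
      (measurableSet_singleton k)
  have h := hs.real_preimage_shift hX hE t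
  simp only [Set.mem_ofPred_eq, zero_add, ← boxSum_shift] at h
  exact h

end Field

/-! ### Covariance bounds from the mixing coefficients -/

section Mixing

variable {m : ℕ} {Ω : Type*} [MeasurableSpace Ω] {P : Measure Ω} [IsProbabilityMeasure P]
  {X : Ω → (Fin m → ℤ) → Fin 2}

lemma abs_cond_real_sub_le_one (A B : Set Ω) : |(cond P A).real B - P.real B| ≤ 1 := by
  by_cases hA : P A = 0
  · have : cond P A = 0 := by simp [cond_eq_zero, hA]
    rw [this, measureReal_zero_apply, zero_sub, abs_neg, abs_of_nonneg measureReal_nonneg]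
    exact measureReal_le_one
  · have := cond_isProbabilityMeasure hA
    have h1 := measureReal_le_one (μ := P) (s := B)
    have h2 := measureReal_nonneg (μ := P) (s := B)
    have h3 := measureReal_le_one (μ := cond P A) (s := B)
    have h4 := measureReal_nonneg (μ := cond P A) (s := B)
    rw [abs_le]
    constructor <;> linarith

/-- The factor `P(A)` on the right is essential: errors are later summed over about `N` sites, and
only `N p` stays bounded. -/
lemma abs_real_inter_sub_mul_le {A B : Set Ω} (hA : MeasurableSet A) {ε : ℝ}
    (h : P A ≠ 0 → |(cond P A).real B - P.real B| ≤ ε) :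
    |P.real (A ∩ B) - P.real A * P.real B| ≤ P.real A * ε := by
  by_cases hA0 : P A = 0
  · have h1 : P.real A = 0 := by simp [measureReal_def, hA0]
    have h2 : P.real (A ∩ B) = 0 :=
      le_antisymm ((measureReal_mono Set.inter_subset_left).trans h1.le) measureReal_nonneg
    simp [h1, h2]
  · have hpos : 0 < P.real A := by
      rw [measureReal_def]; exact ENNReal.toReal_pos hA0 (measure_ne_top _ _)
    have h2 : P.real (A ∩ B) = P.real A * (cond P A).real B := by
      rw [measureReal_def, measureReal_def, measureReal_def, cond_apply hA, ENNReal.toReal_mul,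
        ENNReal.toReal_inv, ← mul_assoc,
        mul_inv_cancel₀ (by simpa [measureReal_def] using hpos.ne'), one_mul]
    rw [h2, ← mul_sub, abs_mul, abs_of_pos hpos]
    exact mul_le_mul_of_nonneg_left (h hA0) hpos.le

lemma abs_real_inter_sub_mul_le_mixPsi (hX : Measurable X) {t : ℝ} {s : Fin m → ℤ}
    {G : Set (Fin m → ℤ)} {A B : Set Ω} (hG : ∀ u ∈ G, t ≤ dist s u)
    (hA : MeasurableSet[sigmaOn X {s}] A) (hB : MeasurableSet[sigmaOn X G] B) :
    |P.real (A ∩ B) - P.real A * P.real B| ≤ P.real A * mixPsi P X t := by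
  refine abs_real_inter_sub_mul_le (sigmaOn_le hX _ _ hA) fun hA0 => ?_
  refine le_csSup ⟨1, ?_⟩ ⟨s, G, A, B, hG, hA, hB, hA0, rfl⟩
  rintro r ⟨s, G, A, B, -, -, -, -, rfl⟩
  exact abs_cond_real_sub_le_one A B

lemma abs_real_inter_sub_mul_le_mixXi (hX : Measurable X) {b : ℕ} {t : ℝ} {s : Fin m → ℤ}
    {G : Set (Fin m → ℤ)} {A B : Set Ω} (hG : ∀ u ∈ G, t ≤ dist s u)
    (hA : MeasurableSet[sigmaBox X b s] A) (hB : MeasurableSet[sigmaOn X G] B) :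
    |P.real (A ∩ B) - P.real A * P.real B| ≤ P.real A * mixXi P X b t := by
  refine abs_real_inter_sub_mul_le (sigmaBox_le hX _ _ _ hA) fun hA0 => ?_
  refine le_csSup ⟨1, ?_⟩ ⟨s, G, A, B, hG, hA, hB, hA0, rfl⟩
  rintro r ⟨s, G, A, B, -, -, -, -, rfl⟩
  exact abs_cond_real_sub_le_one A B

end Mixing

/-! ### The approximate recursion for the number of ones in a box -/

section Recursion

variable {m : ℕ} {Ω : Type*} {X : Ω → (Fin m → ℤ) → Fin 2}

/-- An empty annulus separates the cluster at `t` from the far sites. Used with `b' = 2b` for the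
recursion, and with `b' = b + 1`, `W = box b' t` to compare consecutive radii. -/
lemma siteSum_eq_boxSum_add {b b' : ℕ} (hb : b ≤ b') {t : Fin m → ℤ} {W : Finset (Fin m → ℤ)}
    (hW : box b t ⊆ W) {ω : Ω} (h : ∀ u ∈ box b' t \ box b t, X ω u ≠ 1) :
    ∑ u ∈ W, (X ω u : ℕ) = boxSum X b t ω + ∑ u ∈ W \ box b' t, (X ω u : ℕ) := by
  rw [← Finset.sum_sdiff hW, add_comm, boxSum]
  congr 1
  symm
  refine Finset.sum_subset_zero_on_sdiff (Finset.sdiff_subset_sdiff le_rfl (box_mono hb t)) ?_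
    (fun _ _ => rfl)
  intro u hu
  simp only [Finset.mem_sdiff, not_and, not_not] at hu
  have := h u (Finset.mem_sdiff.2 ⟨hu.2 hu.1.1, hu.1.2⟩)
  generalize X ω u = x at this
  fin_cases x <;> simp_all

lemma one_le_boxSum {b : ℕ} {t : Fin m → ℤ} {ω : Ω} (h : X ω t = 1) : 1 ≤ boxSum X b t ω := by
  have := Finset.single_le_sum (f := fun u => (X ω u : ℕ)) (fun _ _ => Nat.zero_le _)
    (self_mem_box b t)
  rw [h] at this
  exact this

variable [MeasurableSpace Ω] {P : Measure Ω}

lemma real_site_exists_le (A : Set Ω) (V : Finset (Fin m → ℤ)) {δ : ℝ}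
    (hδ : ∀ u ∈ V, P.real {ω | ω ∈ A ∧ X ω u = 1} ≤ δ) :
    P.real {ω | ω ∈ A ∧ ∃ u ∈ V, X ω u = 1} ≤ V.card * δ := by
  have h : {ω | ω ∈ A ∧ ∃ u ∈ V, X ω u = 1} = ⋃ u ∈ V, {ω | ω ∈ A ∧ X ω u = 1} := by
    ext ω
    simp only [Set.mem_ofPred_eq, Set.mem_iUnion, exists_prop]
    constructor
    · rintro ⟨h, u, hu, hx⟩
      exact ⟨u, hu, h, hx⟩
    · rintro ⟨u, hu, h, hx⟩
      exact ⟨h, u, hu, hx⟩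
  rw [h]
  refine (measureReal_biUnion_finset_le V _).trans ((Finset.sum_le_sum hδ).trans ?_)
  simp

lemma integral_site (hX : Measurable X) (t : Fin m → ℤ) :
    ∫ ω, ((X ω t : ℕ) : ℝ) ∂P = P.real {ω | X ω t = 1} := by
  rw [← integral_indicator_one (measurableSet_site hX t)]
  congr 1
  ext ω
  simp only [Set.indicator, Set.mem_ofPred_eq, Pi.one_apply]
  generalize X ω t = x
  fin_cases x <;> simp

lemma real_exists_box_le (hX : Measurable X) (hs : IsStationary P X) (b : ℕ) (t : Fin m → ℤ) :
    P.real {ω | ∃ u ∈ box b t, X ω u = 1} ≤ (2 * b + 1) ^ m * P.real {ω | X ω 0 = 1} := by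
  have h := real_site_exists_le (P := P) (X := X) Set.univ (box b t)
    (δ := P.real {ω | X ω 0 = 1}) fun u _ => by simpa using (hs.real_site hX u).le
  simpa [card_box] using h

variable [IsProbabilityMeasure P]

lemma abs_real_sub_le_of_subset_union {A B D : Set Ω} (hAB : A ⊆ B ∪ D) (hBA : B ⊆ A ∪ D) :
    |P.real A - P.real B| ≤ P.real D := by
  have h1 := (measureReal_mono (μ := P) hAB).trans (measureReal_union_le B D)
  have h2 := (measureReal_mono (μ := P) hBA).trans (measureReal_union_le A D)
  rw [abs_le]
  constructor <;> linarith

lemma real_pair_le (hX : Measurable X) (hs : IsStationary P X) {t u : Fin m → ℤ} {d : ℝ}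
    (hd : d ≤ dist t u) :
    P.real {ω | X ω t = 1 ∧ X ω u = 1} ≤
      P.real {ω | X ω 0 = 1} * (P.real {ω | X ω 0 = 1} + mixPsi P X d) := by
  have h := abs_real_inter_sub_mul_le_mixPsi (P := P) hX (t := d) (s := t) (G := {u})
    (A := {ω | X ω t = 1}) (B := {ω | X ω u = 1}) (by simpa using hd)
    (measurableSet_sigmaOn_site rfl) (measurableSet_sigmaOn_site rfl)
  rw [hs.real_site hX t, hs.real_site hX u] at h
  have h' := (abs_le.1 h).2
  change P.real ({ω | X ω t = 1} ∩ {ω | X ω u = 1}) ≤ _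
  linarith

/-- Union bound over pairs of ones at distance at least `b`. After multiplication by `N` the term in
`p²` dies as `n → ∞`, and exponential mixing beats the volume factor as `b → ∞`. -/
lemma real_annulus_le (hX : Measurable X) (hs : IsStationary P X) (b b' : ℕ) (t : Fin m → ℤ) :
    P.real {ω | X ω t = 1 ∧ ∃ u ∈ box b' t \ box b t, X ω u = 1} ≤
      (2 * b' + 1) ^ m *
        (P.real {ω | X ω 0 = 1} * (P.real {ω | X ω 0 = 1} + mixPsi P X b)) := by
  have hp : 0 ≤ P.real {ω | X ω 0 = 1} := measureReal_nonneg
  have hψ := mixPsi_nonneg (P := P) (X := X) b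
  refine (real_site_exists_le {ω | X ω t = 1} (box b' t \ box b t) (X := X) (P := P)
    fun u hu => real_pair_le hX hs (d := b) ?_).trans ?_
  · rw [Finset.mem_sdiff, mem_box, mem_box, not_le, dist_comm] at hu
    exact hu.2.le
  · refine mul_le_mul_of_nonneg_right ?_ (by positivity)
    have := Finset.card_le_card (Finset.sdiff_subset (s := box b' t) (t := box b t))
    rw [card_box] at this
    exact_mod_cast this

lemma sum_real_site_boxSum_le (hX : Measurable X) (b : ℕ) (t : Fin m → ℤ) (F : Finset ℕ) :
    ∑ k ∈ F, P.real {ω | X ω t = 1 ∧ boxSum X b t ω = k} ≤ P.real {ω | X ω t = 1} := by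
  rw [← measureReal_biUnion_finset]
  · refine measureReal_mono ?_
    intro ω hω
    simp only [Set.mem_iUnion] at hω
    obtain ⟨k, -, h, -⟩ := hω
    exact h
  · intro k _ k' _ hkk'
    refine Set.disjoint_left.2 ?_
    rintro ω ⟨-, h1⟩ ⟨-, h2⟩
    exact hkk' (h1.symm.trans h2)
  · exact fun k _ => sigmaBox_le hX b t _ (measurableSet_sigmaBox b t k)

/-- Three replacements: empty the annulus, decouple cluster and far sum by `mixXi`, then restore the
deleted box to turn the far sum into the full sum. -/
lemma abs_site_sub_le (hX : Measurable X) (hs : IsStationary P X) {b : ℕ}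
    {t : Fin m → ℤ} {W : Finset (Fin m → ℤ)} (hW : box b t ⊆ W) (r : ℕ) :
    |P.real {ω | X ω t = 1 ∧ ∑ u ∈ W, (X ω u : ℕ) = r} -
      ∑ k ∈ Finset.Icc 1 r, P.real {ω | X ω 0 = 1 ∧ boxSum X b 0 ω = k} *
        P.real {ω | ∑ u ∈ W, (X ω u : ℕ) = r - k}| ≤
      P.real {ω | X ω 0 = 1} * ((4 * b + 1) ^ m *
        (2 * P.real {ω | X ω 0 = 1} + mixPsi P X b) + mixXi P X b (2 * b)) := by
  set p := P.real {ω | X ω 0 = 1} with hp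
  set T : Ω → ℕ := fun ω => ∑ u ∈ W \ box (2 * b) t, (X ω u : ℕ) with hT
  set S : Ω → ℕ := fun ω => ∑ u ∈ W, (X ω u : ℕ) with hS
  set D : Set Ω := {ω | X ω t = 1 ∧ ∃ u ∈ box (2 * b) t \ box b t, X ω u = 1} with hD
  set A : ℕ → Set Ω := fun k => {ω | X ω t = 1 ∧ boxSum X b t ω = k} with hA
  have hb : b ≤ 2 * b := by omega
  have hTm : Measurable T := measurable_siteSum hX _
  have hAm : ∀ k, MeasurableSet (A k) := fun k =>
    sigmaBox_le hX b t _ (measurableSet_sigmaBox b t k)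
  have hp0 : 0 ≤ p := measureReal_nonneg
  have hξ0 : 0 ≤ mixXi P X b (2 * b) := mixXi_nonneg _ _
  have hDle : P.real D ≤ (4 * b + 1) ^ m * (p * (p + mixPsi P X b)) := by
    have := real_annulus_le hX hs (P := P) b (2 * b) t
    push_cast at this
    rwa [← mul_assoc 2 2 (b : ℝ), show (2 : ℝ) * 2 = 4 by norm_num] at this
  have h1 : |P.real {ω | X ω t = 1 ∧ S ω = r} -
      P.real {ω | X ω t = 1 ∧ boxSum X b t ω + T ω = r}| ≤ P.real D := by
    apply abs_real_sub_le_of_subset_union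
    all_goals
      rintro ω ⟨hω, hr⟩
      by_cases hωD : ω ∈ D
      · exact Or.inr hωD
      · refine Or.inl ⟨hω, ?_⟩
        have := siteSum_eq_boxSum_add (X := X) (ω := ω) hb hW
          fun u hu hx => hωD ⟨hω, u, hu, hx⟩
        first
        | exact this.symm.trans hr
        | exact this.trans hr
  -- The cluster size is at least `1` because it counts `t` itself, and at most `r`, so the
  -- subtraction `r - k` is never truncated.
  have h2 : P.real {ω | X ω t = 1 ∧ boxSum X b t ω + T ω = r} =
      ∑ k ∈ Finset.Icc 1 r, P.real (A k ∩ {ω | T ω = r - k}) := by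
    rw [← measureReal_biUnion_finset]
    · congr 1
      ext ω
      simp only [Set.mem_ofPred_eq, Set.mem_iUnion, Finset.mem_Icc, exists_prop, hA,
        Set.mem_inter_iff]
      constructor
      · rintro ⟨h, hr⟩
        exact ⟨boxSum X b t ω, ⟨one_le_boxSum h, by omega⟩, ⟨h, rfl⟩, by omega⟩
      · rintro ⟨k, ⟨hk1, hk2⟩, ⟨h, hk⟩, hr⟩
        exact ⟨h, by omega⟩
    · intro k _ k' _ hkk'
      refine Set.disjoint_left.2 ?_
      rintro ω ⟨⟨-, h1⟩, -⟩ ⟨⟨-, h2⟩, -⟩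
      exact hkk' (h1.symm.trans h2)
    · intro k _
      exact (hAm k).inter (hTm (measurableSet_singleton (r - k)))
  have hsumA : ∑ k ∈ Finset.Icc 1 r, P.real (A k) ≤ p :=
    (sum_real_site_boxSum_le hX b t _).trans (hs.real_site hX t).le
  have h3 : ∀ k, |P.real (A k ∩ {ω | T ω = r - k}) -
      P.real (A k) * P.real {ω | T ω = r - k}| ≤ P.real (A k) * mixXi P X b (2 * b) := by
    intro k
    refine abs_real_inter_sub_mul_le_mixXi hX (s := t)
      (G := {u | 2 * (b : ℝ) ≤ dist t u}) (fun u hu => hu) (measurableSet_sigmaBox b t k) ?_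
    refine (measurable_sigmaOn_siteSum ?_) (measurableSet_singleton (r - k))
    intro u hu
    rw [Finset.mem_sdiff, mem_box, not_le, dist_comm] at hu
    push_cast at hu
    exact hu.2.le
  -- `T` and `S` differ only if the deleted box, of `(4b+1)^m` sites, contains a one.
  have h4 : ∀ j, |P.real {ω | T ω = j} - P.real {ω | S ω = j}| ≤ (4 * b + 1) ^ m * p := by
    intro j
    have h := real_exists_box_le hX hs (P := P) (2 * b) t
    push_cast at h
    rw [← mul_assoc, show (2 : ℝ) * 2 = 4 by norm_num] at h
    refine (abs_real_sub_le_of_subset_union ?_ ?_).trans h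
    all_goals
      intro ω hr
      by_cases hω : ∃ u ∈ box (2 * b) t, X ω u = 1
      · exact Or.inr hω
      · left
        push Not at hω
        have : T ω = S ω := Finset.sum_subset_zero_on_sdiff Finset.sdiff_subset
          (fun u hu => by
            simp only [Finset.mem_sdiff, not_and, not_not] at hu
            have := hω u (hu.2 hu.1)
            generalize X ω u = x at this
            fin_cases x <;> simp_all) (fun _ _ => rfl)
        simp only [Set.mem_ofPred_eq] at hr ⊢
        omega
  have h5 : |∑ k ∈ Finset.Icc 1 r, P.real (A k ∩ {ω | T ω = r - k}) -
      ∑ k ∈ Finset.Icc 1 r, P.real (A k) * P.real {ω | S ω = r - k}| ≤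
      p * (mixXi P X b (2 * b) + (4 * b + 1) ^ m * p) := by
    rw [← Finset.sum_sub_distrib]
    -- Each error keeps its weight `P(A k)`; these weights sum to at most `p`, so no factor `r`
    -- appears.
    refine (Finset.abs_sum_le_sum_abs _ _).trans ?_
    calc _ ≤ ∑ k ∈ Finset.Icc 1 r,
          P.real (A k) * (mixXi P X b (2 * b) + (4 * b + 1) ^ m * p) := by
          refine Finset.sum_le_sum fun k _ => ?_
          have hk0 : 0 ≤ P.real (A k) := measureReal_nonneg
          have h6 := abs_le.1 (h3 k)
          have h7 := abs_le.1 (h4 (r - k))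
          rw [abs_le]
          constructor <;> nlinarith
      _ ≤ _ := by
          rw [← Finset.sum_mul]
          exact mul_le_mul_of_nonneg_right hsumA (by positivity)
  have h6 : ∀ k, P.real (A k) = P.real {ω | X ω 0 = 1 ∧ boxSum X b 0 ω = k} := fun k =>
    hs.real_site_boxSum hX b k t
  simp only [h6] at h5
  rw [h2] at h1
  have h7 := abs_le.1 h1
  have h8 := abs_le.1 h5
  rw [abs_le]
  constructor <;> nlinarith

/-- Double counting: on `{S = r}` exactly `r` sites carry a one. -/
lemma sum_real_site_inter (hX : Measurable X) (W : Finset (Fin m → ℤ)) (r : ℕ) :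
    ∑ t ∈ W, P.real {ω | X ω t = 1 ∧ ∑ u ∈ W, (X ω u : ℕ) = r} =
      r * P.real {ω | ∑ u ∈ W, (X ω u : ℕ) = r} := by
  have hE : MeasurableSet {ω | ∑ u ∈ W, (X ω u : ℕ) = r} :=
    measurable_siteSum hX W (measurableSet_singleton r)
  have hA : ∀ t, MeasurableSet {ω | X ω t = 1 ∧ ∑ u ∈ W, (X ω u : ℕ) = r} := fun t =>
    (measurableSet_site hX t).inter hE
  calc _ = ∑ t ∈ W, ∫ ω, {ω | X ω t = 1 ∧ ∑ u ∈ W, (X ω u : ℕ) = r}.indicator (1 : Ω → ℝ) ω ∂P :=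
        Finset.sum_congr rfl fun t _ => (integral_indicator_one (hA t)).symm
    _ = ∫ ω, ∑ t ∈ W,
          {ω | X ω t = 1 ∧ ∑ u ∈ W, (X ω u : ℕ) = r}.indicator (1 : Ω → ℝ) ω ∂P := by
        rw [integral_finsetSum]
        exact fun t _ => (integrable_const (1 : ℝ)).indicator (hA t)
    _ = ∫ ω, r * {ω | ∑ u ∈ W, (X ω u : ℕ) = r}.indicator (1 : Ω → ℝ) ω ∂P := by
        congr 1
        ext ω
        by_cases h : ∑ u ∈ W, (X ω u : ℕ) = r
        · simp only [Set.indicator, Set.mem_ofPred_eq, h, and_true, Pi.one_apply, if_true, mul_one]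
          rw [← h]
          push_cast
          refine Finset.sum_congr rfl fun t _ => ?_
          generalize X ω t = x
          fin_cases x <;> simp
        · simp [Set.indicator, h]
    _ = _ := by
        rw [integral_const_mul, integral_indicator_one hE]

lemma real_boxSum_ge_le (hX : Measurable X) (hs : IsStationary P X) (n R : ℕ) :
    R * P.real {ω | R ≤ boxSum X n 0 ω} ≤ (2 * n + 1) ^ m * P.real {ω | X ω 0 = 1} := by
  have hint : ∀ t, Integrable (fun ω => ((X ω t : ℕ) : ℝ)) P := by
    intro t
    refine Integrable.of_bound (C := 1) ?_ ?_
    · exact ((measurable_of_countable (fun x : Fin 2 => ((x : ℕ) : ℝ))).comp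
        ((measurable_pi_apply t).comp hX)).aestronglyMeasurable
    · refine ae_of_all _ fun ω => ?_
      generalize X ω t = x
      fin_cases x <;> simp
  have hS : (fun ω => (boxSum X n 0 ω : ℝ)) = fun ω => ∑ t ∈ box n 0, ((X ω t : ℕ) : ℝ) := by
    ext ω
    simp [boxSum]
  have h := mul_meas_ge_le_integral_of_nonneg (μ := P) (f := fun ω => (boxSum X n 0 ω : ℝ))
    (ae_of_all _ fun ω => Nat.cast_nonneg _)
    (by rw [hS]; exact integrable_finsetSum _ fun t _ => hint t) R
  simp only [Nat.cast_le] at h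
  refine h.trans (le_of_eq ?_)
  rw [hS, integral_finsetSum _ fun t _ => hint t]
  simp only [integral_site hX, hs.real_site hX, Finset.sum_const, card_box, nsmul_eq_mul]
  push_cast
  rfl

/-- Sum over all sites of the box. Those whose `b`-neighbourhood stays inside get the local
estimate; the boundary layer gets a trivial one, its volume being negligible against `N`. -/
lemma abs_recursion_le (hX : Measurable X) (hs : IsStationary P X) {n b : ℕ} (hbn : b ≤ n)
    (r : ℕ) :
    |r * P.real {ω | boxSum X n 0 ω = r} -
      ∑ k ∈ Finset.Icc 1 r,
        ((2 * n + 1) ^ m * P.real {ω | X ω 0 = 1 ∧ boxSum X b 0 ω = k}) *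
          P.real {ω | boxSum X n 0 ω = r - k}| ≤
      ((2 * n + 1) ^ m - (2 * (n - b) + 1) ^ m) * P.real {ω | X ω 0 = 1} +
      (2 * n + 1) ^ m * (P.real {ω | X ω 0 = 1} * ((4 * b + 1) ^ m *
        (2 * P.real {ω | X ω 0 = 1} + mixPsi P X b) + mixXi P X b (2 * b))) := by
  set p := P.real {ω | X ω 0 = 1} with hp
  set e := P.real {ω | X ω 0 = 1} * ((4 * b + 1) ^ m *
        (2 * P.real {ω | X ω 0 = 1} + mixPsi P X b) + mixXi P X b (2 * b)) with he
  set q := ∑ k ∈ Finset.Icc 1 r, P.real {ω | X ω 0 = 1 ∧ boxSum X b 0 ω = k} *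
        P.real {ω | ∑ u ∈ box n 0, (X ω u : ℕ) = r - k} with hq
  have hp0 : 0 ≤ p := measureReal_nonneg
  have hq0 : 0 ≤ q := Finset.sum_nonneg fun k _ => mul_nonneg measureReal_nonneg measureReal_nonneg
  have hqp : q ≤ p := by
    calc q ≤ ∑ k ∈ Finset.Icc 1 r, P.real {ω | X ω 0 = 1 ∧ boxSum X b 0 ω = k} :=
          Finset.sum_le_sum fun k _ => mul_le_of_le_one_right measureReal_nonneg measureReal_le_one
      _ ≤ p := sum_real_site_boxSum_le hX b 0 _
  have hsub : box (n - b) (0 : Fin m → ℤ) ⊆ box n 0 := box_mono (Nat.sub_le n b) 0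
  have hcard : ((box n (0 : Fin m → ℤ)).card : ℝ) = (2 * n + 1) ^ m := by
    rw [card_box]; push_cast; rfl
  have hcard' : ((box (n - b) (0 : Fin m → ℤ)).card : ℝ) = (2 * (n - b) + 1) ^ m := by
    rw [card_box]; push_cast [Nat.cast_sub hbn]; rfl
  have hin : ∀ t ∈ box (n - b) (0 : Fin m → ℤ),
      |P.real {ω | X ω t = 1 ∧ ∑ u ∈ box n 0, (X ω u : ℕ) = r} - q| ≤ e := by
    intro t ht
    refine abs_site_sub_le hX hs ?_ r
    have := box_subset_box (b := b) ht
    rwa [Nat.sub_add_cancel hbn] at this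
  -- Both quantities lie in `[0, p]`.
  have hout : ∀ t, |P.real {ω | X ω t = 1 ∧ ∑ u ∈ box n 0, (X ω u : ℕ) = r} - q| ≤ p := by
    intro t
    have h1 : P.real {ω | X ω t = 1 ∧ ∑ u ∈ box n 0, (X ω u : ℕ) = r} ≤ p := by
      rw [hp, ← hs.real_site hX t]
      exact measureReal_mono fun ω h => h.1
    have h2 : 0 ≤ P.real {ω | X ω t = 1 ∧ ∑ u ∈ box n 0, (X ω u : ℕ) = r} := measureReal_nonneg
    rw [abs_le]
    constructor <;> linarith
  have he0 : 0 ≤ e := (abs_nonneg _).trans (hin 0 (self_mem_box _ _))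
  have key : |∑ t ∈ box n 0, (P.real {ω | X ω t = 1 ∧ ∑ u ∈ box n 0, (X ω u : ℕ) = r} - q)| ≤
      ((2 * n + 1) ^ m - (2 * (n - b) + 1) ^ m) * p + (2 * n + 1) ^ m * e := by
    refine (Finset.abs_sum_le_sum_abs _ _).trans ?_
    rw [← Finset.sum_sdiff hsub]
    refine add_le_add ((Finset.sum_le_sum fun t _ => hout t).trans ?_)
      ((Finset.sum_le_sum fun t ht => hin t ht).trans ?_)
    · rw [Finset.sum_const, nsmul_eq_mul, Finset.cast_card_sdiff hsub, hcard, hcard']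
    · rw [Finset.sum_const, nsmul_eq_mul, ← hcard]
      exact mul_le_mul_of_nonneg_right (by exact_mod_cast Finset.card_le_card hsub) he0
  rw [Finset.sum_sub_distrib, sum_real_site_inter hX, Finset.sum_const, nsmul_eq_mul, hcard, hq,
    Finset.mul_sum] at key
  simp only [← mul_assoc] at key ⊢
  exact key

end Recursion

/-! ### Compound Poisson laws and Panjer's recursion -/

section CompoundPoisson

/-- The product form, without division, also covers `l = 0`. -/
lemma tsum_mul_jumpLaw {l : ℕ+ → ℝ≥0} (hl : Summable l) (k : ℕ+) :
    ((∑' j, l j : ℝ≥0) : ℝ) * (jumpLaw l k).toReal = l k := by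
  have hsum : (∑' j, (l j : ℝ≥0∞)) = ((∑' j, l j : ℝ≥0) : ℝ≥0∞) := (ENNReal.coe_tsum hl).symm
  have hfin : (∑' j, (l j : ℝ≥0∞)) ≠ ∞ := by rw [hsum]; exact ENNReal.coe_ne_top
  by_cases h0 : (∑' j, (l j : ℝ≥0∞)) = 0
  · have h1 : l k = 0 := by
      have := ENNReal.tsum_eq_zero.1 h0 k
      exact_mod_cast this
    have h2 : (∑' j, l j : ℝ≥0) = 0 := by
      rw [hsum] at h0
      exact_mod_cast h0
    rw [h1, h2]
    simp
  · have hk : jumpLaw l k = PMF.normalize (fun k => (l k : ℝ≥0∞)) h0 hfin k := by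
      unfold jumpLaw
      rw [dif_pos ⟨h0, hfin⟩, PMF.map_apply]
      refine (tsum_eq_single k fun j hj => ?_).trans (if_pos rfl)
      rw [if_neg]
      exact fun h => hj (PNat.coe_injective h.symm)
    rw [hk, PMF.normalize_apply, ENNReal.toReal_mul, ENNReal.toReal_inv, hsum]
    have : ((∑' j, l j : ℝ≥0) : ℝ) ≠ 0 := by
      rw [hsum] at h0
      exact_mod_cast h0
    simp only [ENNReal.coe_toReal]
    field_simp

/-- Independence turns convolution into multiplication of generating series. -/
lemma infinitePi_real_sum_range (q : PMF ℕ) (N j : ℕ) :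
    (Measure.infinitePi fun _ : ℕ => q.toMeasure).real {x | ∑ i ∈ Finset.range N, x i = j} =
      PowerSeries.coeff j ((PowerSeries.mk fun k => (q k).toReal) ^ N) := by
  induction N generalizing j with
  | zero =>
    simp only [Finset.range_zero, Finset.sum_empty, pow_zero, PowerSeries.coeff_one]
    split_ifs with h
    · simp [h]
    · simp [Ne.symm h]
  | succ N ih =>
    set M := Measure.infinitePi fun _ : ℕ => q.toMeasure with hM
    have hind : iIndepFun (fun (i : ℕ) (x : ℕ → ℕ) => x i) M :=
      iIndepFun_infinitePi (P := fun _ : ℕ => q.toMeasure) (X := fun _ (y : ℕ) => y)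
        (fun _ => measurable_id)
    have hI : IndepFun (fun x : ℕ → ℕ => ∑ i ∈ Finset.range N, x i) (fun x => x N) M := by
      have := hind.indepFun_finsetSum_of_notMem (fun i => measurable_pi_apply i)
        (Finset.notMem_range_self (n := N))
      convert this using 1
      ext x
      simp
    have hN : ∀ a, M.real {x | x N = a} = (q a).toReal := by
      intro a
      have h : M.map (fun x => x N) = q.toMeasure :=
        Measure.infinitePi_map_eval (fun _ : ℕ => q.toMeasure) N
      have h' : M.real {x | x N = a} = (M.map (fun x => x N)).real {a} := by
        rw [map_measureReal_apply (measurable_pi_apply N) (measurableSet_singleton a)]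
        rfl
      rw [h', h, measureReal_def, PMF.toMeasure_apply_singleton _ _ (measurableSet_singleton a)]
    have hmeas : Measurable fun x : ℕ → ℕ => ∑ i ∈ Finset.range N, x i :=
      Finset.measurable_sum _ fun i _ => measurable_pi_apply i
    have hset : {x : ℕ → ℕ | ∑ i ∈ Finset.range (N + 1), x i = j} =
        ⋃ c ∈ Finset.HasAntidiagonal.antidiagonal j,
          {x | ∑ i ∈ Finset.range N, x i = c.1} ∩ {x | x N = c.2} := by
      ext x
      simp [Finset.sum_range_succ]
    rw [hset, measureReal_biUnion_finset, pow_succ, PowerSeries.coeff_mul]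
    · refine Finset.sum_congr rfl fun c _ => ?_
      rw [← ih, PowerSeries.coeff_mk, ← hN]
      rw [measureReal_def, measureReal_def, measureReal_def, ← ENNReal.toReal_mul]
      congr 1
      exact hI.measure_inter_preimage_eq_mul _ _ (measurableSet_singleton c.1)
        (measurableSet_singleton c.2)
    · rintro c - c' - hcc
      refine Set.disjoint_left.2 ?_
      rintro x ⟨h1, h2⟩ ⟨h3, h4⟩
      exact hcc (Prod.ext (h1.symm.trans h3) (h2.symm.trans h4))
    · exact fun c _ => (hmeas (measurableSet_singleton c.1)).inter
        ((measurable_pi_apply N : Measurable fun x : ℕ → ℕ => x N) (measurableSet_singleton c.2))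

lemma measurable_randomSum :
    Measurable fun p : ℕ × (ℕ → ℕ) => ∑ i ∈ Finset.range p.1, p.2 i :=
  measurable_from_prod_countable_right fun N =>
    Finset.measurable_sum (Finset.range N) fun i _ => measurable_pi_apply i

instance isProbabilityMeasure_compoundPoisson (l : ℕ+ → ℝ≥0) :
    IsProbabilityMeasure (compoundPoisson l) :=
  Measure.isProbabilityMeasure_map measurable_randomSum.aemeasurable

lemma hasSum_compoundPoisson (l : ℕ+ → ℝ≥0) (j : ℕ) :
    HasSum (fun N => (poissonMeasure (∑' k, l k)).real {N} *
      PowerSeries.coeff j ((PowerSeries.mk fun k => (jumpLaw l k).toReal) ^ N))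
      ((compoundPoisson l).real {j}) := by
  have h : compoundPoisson l {j} = ∑' N, (Measure.infinitePi fun _ : ℕ => (jumpLaw l).toMeasure)
      {x | ∑ i ∈ Finset.range N, x i = j} * poissonMeasure (∑' k, l k) {N} := by
    rw [compoundPoisson, Measure.map_apply measurable_randomSum (measurableSet_singleton j),
      Measure.prod_apply (measurable_randomSum (measurableSet_singleton j)), lintegral_countable']
    rfl
  have hne : ∑' N, (Measure.infinitePi fun _ : ℕ => (jumpLaw l).toMeasure)
      {x | ∑ i ∈ Finset.range N, x i = j} * poissonMeasure (∑' k, l k) {N} ≠ ∞ := by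
    rw [← h]
    exact measure_ne_top _ _
  have h2 := ENNReal.hasSum_toReal hne
  rw [← ENNReal.tsum_toReal_eq (ENNReal.ne_top_of_tsum_ne_top hne), ← h] at h2
  rw [← measureReal_def] at h2
  convert h2 using 2 with N
  rw [← infinitePi_real_sum_range, ENNReal.toReal_mul, mul_comm]
  rfl

lemma poissonMeasure_real_succ (r : ℝ≥0) (N : ℕ) :
    (poissonMeasure r).real {N + 1} * (N + 1) = r * (poissonMeasure r).real {N} := by
  simp only [poissonMeasure_real_singleton]
  rw [Nat.factorial_succ]
  push_cast
  field_simp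
  ring

lemma compoundPoisson_real_zero_pos (l : ℕ+ → ℝ≥0) : 0 < (compoundPoisson l).real {0} := by
  have h := hasSum_compoundPoisson l 0
  have h0 : 0 < (poissonMeasure (∑' k, l k)).real {0} := by
    rw [poissonMeasure_real_singleton]
    positivity
  refine h0.trans_le ?_
  have := le_hasSum h 0 fun N _ => mul_nonneg measureReal_nonneg (by
    rw [← infinitePi_real_sum_range]
    exact measureReal_nonneg)
  simpa using this

/-- Panjer's recursion for the point probabilities of a compound Poisson law. -/
lemma compoundPoisson_recursion {l : ℕ+ → ℝ≥0} (hl : Summable l) (s : ℕ) :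
    (s + 1 : ℝ) * (compoundPoisson l).real {s + 1} =
      ∑ i ∈ Finset.range (s + 1),
        ((i + 1 : ℝ) * l i.succPNat) * (compoundPoisson l).real {s - i} := by
  set H : PowerSeries ℝ := PowerSeries.mk fun k => (jumpLaw l k).toReal with hH
  set w : ℕ → ℝ := fun N => (poissonMeasure (∑' k, l k)).real {N} with hw
  -- Compare coefficients of degree `s` in `(H^(N+1))' = (N+1) H^N H'`.
  have hcoeff : ∀ N : ℕ, (s + 1 : ℝ) * PowerSeries.coeff (s + 1) (H ^ (N + 1)) =
      (N + 1) * ∑ i ∈ Finset.range (s + 1),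
        ((i + 1 : ℝ) * (jumpLaw l (i + 1)).toReal) * PowerSeries.coeff (s - i) (H ^ N) := by
    intro N
    have h1 : PowerSeries.coeff s (PowerSeries.derivative ℝ (H ^ (N + 1))) =
        PowerSeries.coeff (s + 1) (H ^ (N + 1)) * (s + 1) := PowerSeries.coeff_derivative _ _
    rw [mul_comm, ← h1, Derivation.leibniz_pow, Nat.add_sub_cancel, smul_eq_mul, mul_comm (H ^ N),
      map_nsmul, PowerSeries.coeff_mul, Finset.Nat.sum_antidiagonal_eq_sum_range_succ_mk,
      nsmul_eq_mul]
    push_cast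
    congr 1
    refine Finset.sum_congr rfl fun i _ => ?_
    rw [PowerSeries.coeff_derivative, hH, PowerSeries.coeff_mk]
    ring
  have hL : HasSum (fun N => (s + 1 : ℝ) * (w (N + 1) * PowerSeries.coeff (s + 1) (H ^ (N + 1))))
      ((s + 1 : ℝ) * (compoundPoisson l).real {s + 1}) := by
    refine HasSum.mul_left _ ?_
    have h := hasSum_compoundPoisson l (s + 1)
    -- The term `N = 0` vanishes, since `H^0 = 1` has no coefficient of degree `s + 1`.
    rw [← hasSum_nat_add_iff' 1] at h
    simpa [PowerSeries.coeff_one] using h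
  have hR : HasSum (fun N => ∑ i ∈ Finset.range (s + 1), ((i + 1 : ℝ) * l i.succPNat) *
      (w N * PowerSeries.coeff (s - i) (H ^ N)))
      (∑ i ∈ Finset.range (s + 1),
        ((i + 1 : ℝ) * l i.succPNat) * (compoundPoisson l).real {s - i}) :=
    hasSum_sum fun i _ => (hasSum_compoundPoisson l (s - i)).mul_left _
  refine hL.unique ?_
  convert hR using 2 with N
  -- The factor `N + 1` is absorbed by the Poisson weights through `(N+1) w(N+1) = (∑ l) w(N)`.
  rw [mul_left_comm, hcoeff, ← mul_assoc, hw, poissonMeasure_real_succ, Finset.mul_sum]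
  refine Finset.sum_congr rfl fun i _ => ?_
  rw [← tsum_mul_jumpLaw hl i.succPNat, Nat.succPNat_coe, Nat.succ_eq_add_one]
  ring

end CompoundPoisson

/-! ### From the asymptotic recursion to convergence in total variation -/

section Limits

/-- The recursion is linear and determined by its value at `0`, so `p n` must follow the multiple of
`q` that agrees with it at `0`. -/
lemma tendsto_sub_mul_of_recursion {p : ℕ → ℕ → ℝ} {q g : ℕ → ℝ} (hq0 : q 0 ≠ 0)
    (hp : ∀ s : ℕ, Tendsto (fun n => (s + 1 : ℝ) * p n (s + 1) -
      ∑ i ∈ Finset.range (s + 1), g i * p n (s - i)) atTop (𝓝 0))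
    (hq : ∀ s : ℕ, (s + 1 : ℝ) * q (s + 1) = ∑ i ∈ Finset.range (s + 1), g i * q (s - i))
    (r : ℕ) : Tendsto (fun n => p n r - p n 0 / q 0 * q r) atTop (𝓝 0) := by
  induction r using Nat.strong_induction_on with
  | _ r ih =>
    rcases r with - | s
    · simp [div_mul_cancel₀ _ hq0]
    · have h : Tendsto (fun n => (s + 1 : ℝ)⁻¹ * (((s + 1 : ℝ) * p n (s + 1) -
          ∑ i ∈ Finset.range (s + 1), g i * p n (s - i)) +
          ∑ i ∈ Finset.range (s + 1), g i * (p n (s - i) - p n 0 / q 0 * q (s - i)))) atTop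
          (𝓝 ((s + 1 : ℝ)⁻¹ * (0 + ∑ i ∈ Finset.range (s + 1), g i * 0))) :=
        ((hp s).add (tendsto_finsetSum _ fun i _ =>
          (ih (s - i) (by omega)).const_mul (g i))).const_mul _
      simp only [mul_zero, Finset.sum_const_zero, add_zero] at h
      refine h.congr fun n => ?_
      have h1 : ∑ i ∈ Finset.range (s + 1), g i * (p n (s - i) - p n 0 / q 0 * q (s - i)) =
          ∑ i ∈ Finset.range (s + 1), g i * p n (s - i) -
            p n 0 / q 0 * ((s + 1 : ℝ) * q (s + 1)) := by
        rw [hq, Finset.mul_sum, ← Finset.sum_sub_distrib]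
        exact Finset.sum_congr rfl fun i _ => by ring
      rw [h1]
      have : (s + 1 : ℝ) ≠ 0 := by positivity
      field_simp
      ring

/-- Sequences of probability vectors satisfying the same recursion asymptotically as `q`
converge pointwise to `q`, provided that they are tight. -/
lemma tendsto_of_recursion {p : ℕ → ℕ → ℝ} {q g : ℕ → ℝ} (hq0 : 0 < q 0)
    (hp : ∀ s : ℕ, Tendsto (fun n => (s + 1 : ℝ) * p n (s + 1) -
      ∑ i ∈ Finset.range (s + 1), g i * p n (s - i)) atTop (𝓝 0))
    (hq : ∀ s : ℕ, (s + 1 : ℝ) * q (s + 1) = ∑ i ∈ Finset.range (s + 1), g i * q (s - i))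
    (hqnn : ∀ r, 0 ≤ q r) (hqsum : HasSum q 1)
    (hp0 : ∀ᶠ n in atTop, 0 ≤ p n 0 ∧ p n 0 ≤ 1)
    (hp1 : ∀ R, ∀ᶠ n in atTop, ∑ r ∈ Finset.range R, p n r ≤ 1) {C : ℝ}
    (hpt : ∀ R : ℕ, 0 < R → ∀ᶠ n in atTop, 1 - C / R ≤ ∑ r ∈ Finset.range R, p n r) (r : ℕ) :
    Tendsto (fun n => p n r) atTop (𝓝 (q r)) := by
  have hsub := tendsto_sub_mul_of_recursion hq0.ne' hp hq
  have hc : Tendsto (fun n => p n 0 / q 0) atTop (𝓝 1) := by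
    rw [Metric.tendsto_atTop']
    intro ε hε
    have hK : 0 < 2 + 1 / q 0 := by positivity
    -- With `a = p n 0 / q 0 ≤ 1 / q 0` and both masses below `R` within `δ` of `1`, one gets `1 -
    -- 2δ ≤ a ≤ 1 + δ + δ / q 0`, hence `|a - 1| ≤ ε / 2`.
    set δ := ε / (2 * (2 + 1 / q 0)) with hδ
    have hδ0 : 0 < δ := by positivity
    have h1 : Tendsto (fun R : ℕ => C / R) atTop (𝓝 0) :=
      tendsto_const_nhds.div_atTop tendsto_natCast_atTop_atTop
    obtain ⟨R, hR1, hR2, hR3⟩ := ((h1.eventually (gt_mem_nhds hδ0)).and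
      ((hqsum.tendsto_sum_nat.eventually (lt_mem_nhds (show 1 - δ < 1 by linarith))).and
        (eventually_gt_atTop 0))).exists
    have h2 : Tendsto (fun n => ∑ r ∈ Finset.range R, (p n r - p n 0 / q 0 * q r)) atTop (𝓝 0) := by
      simpa using tendsto_finsetSum (Finset.range R) fun r _ => hsub r
    have h3 : ∑ r ∈ Finset.range R, q r ≤ 1 := sum_le_hasSum _ (fun r _ => hqnn r) hqsum
    have hev := ((h2.eventually (Metric.ball_mem_nhds 0 hδ0)).and
      (hp0.and ((hp1 R).and (hpt R hR3))))
    obtain ⟨n₀, hn₀⟩ := eventually_atTop.1 hev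
    refine ⟨n₀, fun n hn => ?_⟩
    obtain ⟨h4, ⟨h5, h6⟩, h7, h8⟩ := hn₀ n hn.le
    rw [dist_zero_right, Real.norm_eq_abs, Finset.sum_sub_distrib,
      ← Finset.mul_sum, abs_lt] at h4
    set a := p n 0 / q 0 with ha
    set σ := ∑ r ∈ Finset.range R, q r with hσ
    have ha0 : 0 ≤ a := div_nonneg h5 hq0.le
    have ha1 : a ≤ 1 / q 0 := div_le_div_of_nonneg_right h6 hq0.le
    have h9 : a * σ ≤ a := mul_le_of_le_one_right ha0 h3
    have h10 : a * (1 - δ) ≤ a * σ := mul_le_mul_of_nonneg_left hR2.le ha0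
    have h11 : a * δ ≤ 1 / q 0 * δ := mul_le_mul_of_nonneg_right ha1 hδ0.le
    have h12 : δ * (2 + 1 / q 0) = ε / 2 := by
      rw [hδ]; field_simp
    have h13 : 0 ≤ 1 / q 0 * δ := by positivity
    rw [Real.dist_eq, abs_lt]
    constructor <;> nlinarith
  have h := (hsub r).add (hc.mul_const (q r))
  simpa using h

lemma tvDist_nonneg (μ ν : Measure ℕ) : 0 ≤ tvDist μ ν :=
  Real.iSup_nonneg fun _ => abs_nonneg _

/-- The tail of `μ` is at most that of `ν` plus the discrepancy on `range R`, so only the tail of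
`ν` enters. -/
lemma tvDist_le (μ ν : Measure ℕ) [IsProbabilityMeasure μ] [IsProbabilityMeasure ν] (R : ℕ) :
    tvDist μ ν ≤ 2 * ∑ j ∈ Finset.range R, |μ.real {j} - ν.real {j}| +
      2 * (1 - ∑ j ∈ Finset.range R, ν.real {j}) := by
  classical
  set F : Set ℕ := (Finset.range R : Set ℕ) with hF
  have hFm : MeasurableSet F := MeasurableSet.of_discrete
  set D := ∑ j ∈ Finset.range R, |μ.real {j} - ν.real {j}| with hD
  have hsum : ∀ (ρ : Measure ℕ) [IsProbabilityMeasure ρ] (A : Set ℕ),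
      ρ.real (A ∩ F) = ∑ j ∈ (Finset.range R).filter (· ∈ A), ρ.real {j} := by
    intro ρ _ A
    rw [sum_measureReal_singleton]
    congr 1
    ext j
    simp [hF, and_comm]
  have htail : ∀ (ρ : Measure ℕ) [IsProbabilityMeasure ρ] (A : Set ℕ),
      ρ.real (A \ F) ≤ 1 - ∑ j ∈ Finset.range R, ρ.real {j} := by
    intro ρ _ A
    rw [sum_measureReal_singleton, ← probReal_compl_eq_one_sub hFm]
    exact measureReal_mono fun x hx => hx.2
  refine ciSup_le fun A => ?_
  have hμ := measureReal_inter_add_sdiff (μ := μ) (s := A) hFm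
  have hν := measureReal_inter_add_sdiff (μ := ν) (s := A) hFm
  have h1 : |μ.real (A ∩ F) - ν.real (A ∩ F)| ≤ D := by
    rw [hsum, hsum, ← Finset.sum_sub_distrib]
    refine (Finset.abs_sum_le_sum_abs _ _).trans ?_
    exact Finset.sum_le_sum_of_subset_of_nonneg (Finset.filter_subset _ _)
      fun _ _ _ => abs_nonneg _
  have h2 : |∑ j ∈ Finset.range R, μ.real {j} - ∑ j ∈ Finset.range R, ν.real {j}| ≤ D := by
    rw [← Finset.sum_sub_distrib]
    exact Finset.abs_sum_le_sum_abs _ _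
  have h3 := htail μ A
  have h4 := htail ν A
  have h5 : 0 ≤ μ.real (A \ F) := measureReal_nonneg
  have h6 : 0 ≤ ν.real (A \ F) := measureReal_nonneg
  rw [abs_le] at h1 h2 ⊢
  constructor <;> linarith [h1.1, h1.2, h2.1, h2.2]

lemma hasSum_real_singleton (ν : Measure ℕ) [IsProbabilityMeasure ν] :
    HasSum (fun j => ν.real {j}) 1 := by
  have h : ∑' j, ν {j} = 1 := by
    simpa using (lintegral_countable' (μ := ν) fun _ => 1).symm
  have h' := ENNReal.hasSum_toReal (f := fun j => ν {j}) (by rw [h]; exact ENNReal.one_ne_top)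
  rw [← ENNReal.tsum_toReal_eq (fun j => measure_ne_top _ _), h] at h'
  exact h'

/-- Scheffé's lemma for laws on `ℕ`. -/
lemma tendsto_tvDist {μ : ℕ → Measure ℕ} {ν : Measure ℕ} [IsProbabilityMeasure ν]
    (hμ : ∀ᶠ n in atTop, IsProbabilityMeasure (μ n))
    (h : ∀ j, Tendsto (fun n => (μ n).real {j}) atTop (𝓝 (ν.real {j}))) :
    Tendsto (fun n => tvDist (μ n) ν) atTop (𝓝 0) := by
  rw [tendsto_order]
  refine ⟨fun a ha => Eventually.of_forall fun n => ha.trans_le (tvDist_nonneg _ _),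
    fun ε hε => ?_⟩
  obtain ⟨R, hR⟩ := ((hasSum_real_singleton ν).tendsto_sum_nat.eventually
    (lt_mem_nhds (show 1 - ε / 4 < 1 by linarith))).exists
  have h1 : Tendsto (fun n => ∑ j ∈ Finset.range R, |(μ n).real {j} - ν.real {j}|) atTop
      (𝓝 0) := by
    have := tendsto_finsetSum (Finset.range R) fun j _ =>
      ((h j).sub_const (ν.real {j})).abs
    simpa using this
  filter_upwards [hμ, h1.eventually (gt_mem_nhds (show 0 < ε / 4 by positivity))] with n hn hn1
  have := tvDist_le (μ n) ν R
  linarith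

lemma summable_pow_mul_exp_neg (m : ℕ) {c₂ : ℝ} (hc₂ : 0 < c₂) :
    Summable fun b : ℕ => (2 * (b : ℝ) + 3) ^ m * Real.exp (-c₂ * b) := by
  -- The shift avoids `b = 0`, where `b ^ m` can vanish; afterwards `2(b+1) + 3 ≤ 5(b+1)`.
  rw [← summable_nat_add_iff 1]
  have h := ((summable_nat_add_iff 1).2
    (Real.summable_pow_mul_exp_neg_nat_mul m hc₂)).mul_left ((5 : ℝ) ^ m)
  refine Summable.of_nonneg_of_le (fun b => by positivity) (fun b => ?_) h
  rw [← mul_assoc, ← mul_pow]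
  refine mul_le_mul_of_nonneg_right (pow_le_pow_left₀ (by positivity) ?_ m) (by positivity)
  push_cast
  have : (0 : ℝ) ≤ b := Nat.cast_nonneg b
  linarith

end Limits

/-! ### Error bounds in terms of the constants of the hypotheses -/

section ErrorBounds

variable {m : ℕ} {Ω : Type*} [MeasurableSpace Ω] {P : Measure Ω} [IsProbabilityMeasure P]
  {X : Ω → (Fin m → ℤ) → Fin 2}

/-- For fixed `b` the boundary term and `c / N` vanish as `n → ∞`; what is left is exponentially
small in `b`, up to a polynomial factor. -/
lemma recursion_error_le (hX : Measurable X) (hs : IsStationary P X) {n b : ℕ} (hb : 0 < b)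
    (hbn : b ≤ n) {c c₁ c₂ : ℝ} (hc : (2 * (n : ℝ) + 1) ^ m * P.real {ω | X ω 0 = 1} ≤ c)
    (hψ : ∀ t : ℝ, 0 < t → mixPsi P X t ≤ c₁ * Real.exp (-c₂ * t))
    (hξ : mixXi P X b (2 * b) ≤ c₁ * Real.exp (-c₂ * (2 * b))) (r : ℕ) :
    |r * P.real {ω | boxSum X n 0 ω = r} -
      ∑ k ∈ Finset.Icc 1 r,
        ((2 * n + 1) ^ m * P.real {ω | X ω 0 = 1 ∧ boxSum X b 0 ω = k}) *
          P.real {ω | boxSum X n 0 ω = r - k}| ≤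
      c * (1 - ((2 * (n - b) + 1) / (2 * n + 1)) ^ m) +
      c * ((4 * b + 1) ^ m * (2 * (c / (2 * n + 1) ^ m) + c₁ * Real.exp (-c₂ * b)) +
        c₁ * Real.exp (-c₂ * (2 * b))) := by
  refine (abs_recursion_le hX hs hbn r).trans ?_
  set p := P.real {ω | X ω 0 = 1} with hp
  set N : ℝ := (2 * (n : ℝ) + 1) ^ m with hN
  have hN0 : 0 < N := by positivity
  have hp0 : 0 ≤ p := measureReal_nonneg
  have hψb := hψ b (by exact_mod_cast hb)
  have hψ0 := mixPsi_nonneg (P := P) (X := X) b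
  have hξ0 : 0 ≤ mixXi P X b (2 * b) := mixXi_nonneg _ _
  have hpN : p ≤ c / N := by
    rw [le_div_iff₀ hN0]
    linarith
  have hbn' : (b : ℝ) ≤ n := by exact_mod_cast hbn
  refine add_le_add ?_ ?_
  · have h1 : N - (2 * ((n : ℝ) - b) + 1) ^ m =
        N * (1 - ((2 * ((n : ℝ) - b) + 1) / (2 * n + 1)) ^ m) := by
      rw [div_pow, ← hN]
      field_simp
    have h2 : 0 ≤ 1 - ((2 * ((n : ℝ) - b) + 1) / (2 * n + 1)) ^ m := by
      rw [sub_nonneg]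
      refine pow_le_one₀ (div_nonneg (by linarith) (by positivity)) ?_
      rw [div_le_one (by positivity)]
      have : (0 : ℝ) ≤ b := Nat.cast_nonneg b
      linarith
    rw [h1]
    calc _ = (N * p) * (1 - ((2 * ((n : ℝ) - b) + 1) / (2 * n + 1)) ^ m) := by ring
      _ ≤ _ := mul_le_mul_of_nonneg_right hc h2
  · rw [← mul_assoc]
    refine mul_le_mul hc ?_ (by positivity) ((by positivity : 0 ≤ N * p).trans hc)
    refine add_le_add (mul_le_mul_of_nonneg_left ?_ (by positivity)) hξ
    linarith

/-- The two events differ only if the shell between radii `b` and `b + 1` contains a one. Since `k ≥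
1`, dividing by `k` only helps. -/
lemma boxSum_succ_error_le (hX : Measurable X) (hs : IsStationary P X) {n b : ℕ} (hb : 0 < b)
    {c c₁ c₂ : ℝ} (hc : (2 * (n : ℝ) + 1) ^ m * P.real {ω | X ω 0 = 1} ≤ c)
    (hψ : ∀ t : ℝ, 0 < t → mixPsi P X t ≤ c₁ * Real.exp (-c₂ * t)) (k : ℕ+) :
    |(2 * (n : ℝ) + 1) ^ m / ((k : ℕ) : ℝ) *
        P.real {ω | X ω 0 = 1 ∧ boxSum X b 0 ω = (k : ℕ)} -
      (2 * (n : ℝ) + 1) ^ m / ((k : ℕ) : ℝ) *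
        P.real {ω | X ω 0 = 1 ∧ boxSum X (b + 1) 0 ω = (k : ℕ)}| ≤
      c * ((2 * b + 3) ^ m * (c / (2 * n + 1) ^ m + c₁ * Real.exp (-c₂ * b))) := by
  set p := P.real {ω | X ω 0 = 1} with hp
  set N : ℝ := (2 * (n : ℝ) + 1) ^ m with hN
  have hN0 : 0 < N := by positivity
  have hp0 : 0 ≤ p := measureReal_nonneg
  have hψb := hψ b (by exact_mod_cast hb)
  have hψ0 := mixPsi_nonneg (P := P) (X := X) b
  have hk : (1 : ℝ) ≤ ((k : ℕ) : ℝ) := by exact_mod_cast k.pos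
  have hpN : p ≤ c / N := by
    rw [le_div_iff₀ hN0]
    linarith
  have hsub : |P.real {ω | X ω 0 = 1 ∧ boxSum X b 0 ω = (k : ℕ)} -
      P.real {ω | X ω 0 = 1 ∧ boxSum X (b + 1) 0 ω = (k : ℕ)}| ≤
      (2 * b + 3) ^ m * (p * (p + mixPsi P X b)) := by
    have h := real_annulus_le hX hs (P := P) b (b + 1) 0
    push_cast at h
    rw [show 2 * ((b : ℝ) + 1) + 1 = 2 * b + 3 by ring] at h
    refine (abs_real_sub_le_of_subset_union ?_ ?_).trans h
    all_goals
      rintro ω ⟨hω, hr⟩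
      by_cases hD : ∃ u ∈ box (b + 1) 0 \ box b 0, X ω u = 1
      · exact Or.inr ⟨hω, hD⟩
      · push Not at hD
        have h1 := siteSum_eq_boxSum_add (X := X) (ω := ω) (Nat.le_succ b)
          (box_mono (Nat.le_succ b) 0) hD
        rw [Nat.succ_eq_add_one, Finset.sdiff_self, Finset.sum_empty, add_zero] at h1
        change boxSum X (b + 1) 0 ω = _ at h1
        exact Or.inl ⟨hω, by omega⟩
  rw [← mul_sub, abs_mul, abs_of_pos (by positivity)]
  calc _ ≤ N * ((2 * b + 3) ^ m * (p * (p + mixPsi P X b))) :=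
        mul_le_mul (div_le_self hN0.le hk) hsub (abs_nonneg _) hN0.le
    _ = (N * p) * ((2 * b + 3) ^ m * (p + mixPsi P X b)) := by ring
    _ ≤ _ := by
        refine mul_le_mul hc ?_ (by positivity) ((by positivity : 0 ≤ N * p).trans hc)
        exact mul_le_mul_of_nonneg_left (by linarith) (by positivity)

end ErrorBounds

end BinaryField

/-! ### The limit theorem -/

theorem mainTheorem6 {m : ℕ} (hm : 1 ≤ m) {Ω : ℕ → Type*} [∀ n, MeasurableSpace (Ω n)]
    (P : ∀ n, Measure (Ω n)) [∀ n, IsProbabilityMeasure (P n)]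
    (X : ∀ n, Ω n → (Fin m → ℤ) → Fin 2)
    (hmeas : ∀ n, 1 ≤ n → Measurable (X n))
    (hstat : ∀ n, 1 ≤ n → BinaryField.IsStationary (P n) (X n))
    (hmarkov : ∀ n, 1 ≤ n → BinaryField.IsMarkov (P n) (X n))
    (c : ℝ) (hc : 0 < c)
    (hi : ∀ n : ℕ, 1 ≤ n →
      (2 * (n : ℝ) + 1) ^ m * ∫ ω, ((X n ω 0 : ℕ) : ℝ) ∂(P n) ≤ c)
    (lamB : ℕ → ℕ+ → ℝ)
    (hii : ∀ b : ℕ, 0 < b → ∀ k : ℕ+,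
      Tendsto (fun n : ℕ => (2 * (n : ℝ) + 1) ^ m / ((k : ℕ) : ℝ) *
          (P n).real {ω | X n ω 0 = 1 ∧ BinaryField.boxSum (X n) b 0 ω = (k : ℕ)})
        atTop (𝓝 (lamB b k)))
    (c₁ c₂ : ℝ) (hc₂ : 0 < c₂)
    (hPsi : ∀ n : ℕ, 1 ≤ n → ∀ t : ℝ, 0 < t →
      BinaryField.mixPsi (P n) (X n) t ≤ c₁ * Real.exp (-c₂ * t))
    (hXi : ∀ n : ℕ, 1 ≤ n → ∀ b : ℕ, 0 < b → ∀ t : ℝ, 2 * (b : ℝ) ≤ t →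
      BinaryField.mixXi (P n) (X n) b t ≤ c₁ * Real.exp (-c₂ * t)) :
    ∃ lam : ℕ+ → ℝ≥0,
      (∀ k : ℕ+, Tendsto (fun b : ℕ => lamB b k) atTop (𝓝 (lam k : ℝ))) ∧
      Summable lam ∧
      Tendsto (fun n : ℕ =>
          BinaryField.tvDist ((P n).map (BinaryField.boxSum (X n) n 0))
            (BinaryField.compoundPoisson lam))
        atTop (𝓝 0) := by
  set N : ℕ → ℝ := fun n => (2 * (n : ℝ) + 1) ^ m with hN
  have hN0 : ∀ n, 0 < N n := fun n => by positivity
  have hlin : Tendsto (fun n : ℕ => 2 * (n : ℝ) + 1) atTop atTop :=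
    tendsto_atTop_add_const_right _ _ (tendsto_natCast_atTop_atTop.const_mul_atTop two_pos)
  have hNtop : Tendsto N atTop atTop := (tendsto_pow_atTop (by omega)).comp hlin
  have hcN : Tendsto (fun n => c / N n) atTop (𝓝 0) := tendsto_const_nhds.div_atTop hNtop
  have hi' : ∀ n, 1 ≤ n → N n * (P n).real {ω | X n ω 0 = 1} ≤ c := fun n hn => by
    rw [← BinaryField.integral_site (hmeas n hn)]
    exact hi n hn
  -- `lamB b k` is a Cauchy sequence in `b`
  have hdist : ∀ (b : ℕ) (k : ℕ+), 0 < b → |lamB b k - lamB (b + 1) k| ≤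
      c * ((2 * b + 3) ^ m * (c₁ * Real.exp (-c₂ * b))) := by
    intro b k hb
    have h1 := ((hii b hb k).sub (hii (b + 1) b.succ_pos k)).abs
    have h2 : Tendsto (fun n => c * ((2 * (b : ℝ) + 3) ^ m *
        (c / N n + c₁ * Real.exp (-c₂ * b)))) atTop
        (𝓝 (c * ((2 * (b : ℝ) + 3) ^ m * (0 + c₁ * Real.exp (-c₂ * b))))) :=
      ((hcN.add_const _).const_mul _).const_mul _
    rw [zero_add] at h2
    refine le_of_tendsto_of_tendsto h1 h2 ?_
    filter_upwards [eventually_ge_atTop 1] with n hn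
    exact BinaryField.boxSum_succ_error_le (hmeas n hn) (hstat n hn) hb (hi' n hn)
      (hPsi n hn) k
  have hsummable := BinaryField.summable_pow_mul_exp_neg m hc₂
  have hlim : ∀ k, ∃ x, Tendsto (fun b => lamB b k) atTop (𝓝 x) := by
    intro k
    have h : CauchySeq fun b => lamB (b + 1) k := by
      refine cauchySeq_of_summable_dist (Summable.of_nonneg_of_le (fun _ => dist_nonneg)
        (fun b => ?_) (((summable_nat_add_iff 1).2 hsummable).mul_left (c * c₁)))
      refine (hdist (b + 1) k b.succ_pos).trans (le_of_eq ?_)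
      ring
    obtain ⟨x, hx⟩ := cauchySeq_tendsto_of_complete h
    exact ⟨x, (tendsto_add_atTop_iff_nat 1).1 hx⟩
  choose lam₀ hlam₀ using hlim
  have hlamB0 : ∀ b k, 0 < b → 0 ≤ lamB b k := fun b k hb =>
    ge_of_tendsto' (hii b hb k) fun n => mul_nonneg (by positivity) measureReal_nonneg
  have hlam0 : ∀ k, 0 ≤ lam₀ k := fun k => ge_of_tendsto (hlam₀ k) <| by
    filter_upwards [eventually_gt_atTop 0] with b hb using hlamB0 b k hb
  -- For distinct `k` the events are disjoint parts of `{X(0) = 1}`, so their total is at most `N p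
  -- ≤ c`; the bound survives both limits.
  have hsumle : ∀ F : Finset ℕ+, ∑ k ∈ F, lam₀ k ≤ c := by
    intro F
    refine le_of_tendsto (tendsto_finsetSum F fun k _ => hlam₀ k) ?_
    filter_upwards [eventually_gt_atTop 0] with b hb
    refine le_of_tendsto (tendsto_finsetSum F fun k _ => hii b hb k) ?_
    filter_upwards [eventually_ge_atTop 1] with n hn
    refine le_trans ?_ (hi' n hn)
    calc _ ≤ ∑ k ∈ F, N n * (P n).real
          {ω | X n ω 0 = 1 ∧ BinaryField.boxSum (X n) b 0 ω = (k : ℕ)} := by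
          refine Finset.sum_le_sum fun k _ => mul_le_mul_of_nonneg_right ?_ measureReal_nonneg
          exact div_le_self (hN0 n).le (by exact_mod_cast k.pos)
      _ ≤ _ := by
          rw [← Finset.mul_sum]
          refine mul_le_mul_of_nonneg_left ?_ (hN0 n).le
          have := BinaryField.sum_real_site_boxSum_le (P := P n) (hmeas n hn) b 0
            (F.map ⟨fun k : ℕ+ => (k : ℕ), PNat.coe_injective⟩)
          simpa using this
  let lam : ℕ+ → ℝ≥0 := fun k => ⟨lam₀ k, hlam0 k⟩
  have hlamsum : Summable lam := by
    rw [← NNReal.summable_coe]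
    exact summable_of_sum_le hlam0 hsumle
  refine ⟨lam, hlam₀, hlamsum, ?_⟩
  -- asymptotic recursion for the law of the number of ones in the box
  have hdecay : Tendsto (fun b : ℕ => c * ((4 * (b : ℝ) + 1) ^ m *
      (c₁ * Real.exp (-c₂ * b)) + c₁ * Real.exp (-c₂ * (2 * b)))) atTop (𝓝 0) := by
    have h2 : Tendsto (fun b : ℕ => Real.exp (-c₂ * (2 * (b : ℝ)))) atTop (𝓝 0) := by
      refine Real.tendsto_exp_atBot.comp ?_
      refine Tendsto.const_mul_atTop_of_neg (by linarith) ?_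
      exact tendsto_natCast_atTop_atTop.const_mul_atTop two_pos
    have h1 : Tendsto (fun b : ℕ => (4 * (b : ℝ) + 1) ^ m * Real.exp (-c₂ * b)) atTop (𝓝 0) := by
      have h := hsummable.tendsto_atTop_zero.const_mul ((2 : ℝ) ^ m)
      rw [mul_zero] at h
      refine squeeze_zero (fun b => by positivity) (fun b => ?_) h
      rw [← mul_assoc, ← mul_pow]
      refine mul_le_mul_of_nonneg_right (pow_le_pow_left₀ (by positivity) ?_ m) (by positivity)
      linarith
    have h := ((h1.const_mul c₁).add (h2.const_mul c₁)).const_mul c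
    simp only [mul_zero, add_zero] at h
    refine h.congr fun b => ?_
    ring
  have hratio : ∀ b : ℕ, Tendsto (fun n : ℕ =>
      ((2 * ((n : ℝ) - b) + 1) / (2 * n + 1)) ^ m) atTop (𝓝 1) := by
    intro b
    have h : Tendsto (fun n : ℕ => 1 - 2 * (b : ℝ) / (2 * n + 1)) atTop (𝓝 (1 - 0)) :=
      tendsto_const_nhds.sub (tendsto_const_nhds.div_atTop hlin)
    have h' := h.pow m
    rw [sub_zero, one_pow] at h'
    refine h'.congr fun n => ?_
    congr 1
    field_simp
    ring
  set p : ℕ → ℕ → ℝ := fun n r => (P n).real {ω | BinaryField.boxSum (X n) n 0 ω = r} with hp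
  have hrec : ∀ s : ℕ, Tendsto (fun n => (s + 1 : ℝ) * p n (s + 1) -
      ∑ i ∈ Finset.range (s + 1), ((i + 1 : ℝ) * lam i.succPNat) * p n (s - i)) atTop (𝓝 0) := by
    intro s
    have hL : Tendsto (fun b : ℕ => c * ((4 * (b : ℝ) + 1) ^ m *
        (c₁ * Real.exp (-c₂ * b)) + c₁ * Real.exp (-c₂ * (2 * b))) +
        ∑ i ∈ Finset.range (s + 1), (i + 1 : ℝ) * |lamB b i.succPNat - lam i.succPNat|)
        atTop (𝓝 0) := by
      have h : Tendsto (fun b : ℕ => ∑ i ∈ Finset.range (s + 1),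
          (i + 1 : ℝ) * |lamB b i.succPNat - lam i.succPNat|) atTop (𝓝 (∑ i ∈ Finset.range (s + 1),
          (i + 1 : ℝ) * |lam₀ i.succPNat - lam i.succPNat|)) :=
        tendsto_finsetSum _ fun i _ => (((hlam₀ _).sub_const _).abs).const_mul _
      have h0 : ∀ k, lam₀ k - lam k = 0 := fun k => sub_self _
      simp only [h0, abs_zero, mul_zero, Finset.sum_const_zero] at h
      simpa using hdecay.add h
    rw [Metric.tendsto_nhds]
    intro ε hε
    -- The radius `b` is fixed first, making the `n → ∞` limit of the error smaller than `ε`; only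
    -- then is `n` taken large.
    obtain ⟨b, hbε, hb⟩ := ((hL.eventually (gt_mem_nhds hε)).and (eventually_gt_atTop 0)).exists
    set a : ℕ → ℕ → ℝ := fun n k =>
      N n * (P n).real {ω | X n ω 0 = 1 ∧ BinaryField.boxSum (X n) b 0 ω = k} with ha
    -- The definition of `λ^b(k)` divides by `k`, which restores the factor `k = i + 1` of Panjer's
    -- recursion.
    have hlima : ∀ i : ℕ, Tendsto (fun n => a n (i + 1)) atTop
        (𝓝 ((i + 1 : ℝ) * lamB b i.succPNat)) := by
      intro i
      refine ((hii b hb i.succPNat).const_mul (i + 1 : ℝ)).congr fun n => ?_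
      simp only [Nat.succPNat_coe, Nat.succ_eq_add_one, ha, hN]
      push_cast
      have : (i + 1 : ℝ) ≠ 0 := by positivity
      field_simp
    have hU : Tendsto (fun n : ℕ => (c * (1 - ((2 * ((n : ℝ) - b) + 1) / (2 * n + 1)) ^ m) +
        c * ((4 * (b : ℝ) + 1) ^ m * (2 * (c / N n) + c₁ * Real.exp (-c₂ * b)) +
          c₁ * Real.exp (-c₂ * (2 * b)))) +
        ∑ i ∈ Finset.range (s + 1), |a n (i + 1) - (i + 1 : ℝ) * lam i.succPNat|) atTop
        (𝓝 ((c * (1 - 1) + c * ((4 * (b : ℝ) + 1) ^ m * (2 * 0 + c₁ * Real.exp (-c₂ * b)) +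
          c₁ * Real.exp (-c₂ * (2 * b)))) + ∑ i ∈ Finset.range (s + 1),
            |(i + 1 : ℝ) * lamB b i.succPNat - (i + 1 : ℝ) * lam i.succPNat|)) := by
      refine (((tendsto_const_nhds.sub (hratio b)).const_mul c).add
        (((((hcN.const_mul 2).add_const _).const_mul _).add_const _).const_mul c)).add ?_
      exact tendsto_finsetSum _ fun i _ => ((hlima i).sub_const _).abs
    have hlt : (c * (1 - 1) + c * ((4 * (b : ℝ) + 1) ^ m * (2 * 0 + c₁ * Real.exp (-c₂ * b)) +
          c₁ * Real.exp (-c₂ * (2 * b)))) + ∑ i ∈ Finset.range (s + 1),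
            |(i + 1 : ℝ) * lamB b i.succPNat - (i + 1 : ℝ) * lam i.succPNat| < ε := by
      refine lt_of_eq_of_lt ?_ hbε
      congr 1
      · ring
      · refine Finset.sum_congr rfl fun i _ => ?_
        rw [← mul_sub, abs_mul, abs_of_pos (by positivity)]
    filter_upwards [hU.eventually (gt_mem_nhds hlt), eventually_ge_atTop 1, eventually_ge_atTop b]
      with n hn hn1 hnb
    refine lt_of_le_of_lt ?_ hn
    rw [dist_zero_right, Real.norm_eq_abs]
    have h1 := BinaryField.recursion_error_le (hmeas n hn1) (hstat n hn1) hb hnb (hi' n hn1)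
      (hPsi n hn1) (hXi n hn1 b hb (2 * b) le_rfl) (s + 1)
    have h2 : ∑ k ∈ Finset.Icc 1 (s + 1), a n k * p n (s + 1 - k) =
        ∑ i ∈ Finset.range (s + 1), a n (i + 1) * p n (s - i) := by
      rw [Finset.range_eq_Ico]
      have h := Finset.sum_Ico_add' (fun k => a n k * p n (s + 1 - k)) 0 (s + 1) 1
      simp only [Nat.add_sub_add_right] at h
      rw [h]
      rfl
    change |((s + 1 : ℕ) : ℝ) * p n (s + 1) -
      ∑ k ∈ Finset.Icc 1 (s + 1), a n k * p n (s + 1 - k)| ≤ _ at h1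
    rw [h2] at h1
    push_cast at h1
    have h3 : |∑ i ∈ Finset.range (s + 1), a n (i + 1) * p n (s - i) -
        ∑ i ∈ Finset.range (s + 1), ((i + 1 : ℝ) * lam i.succPNat) * p n (s - i)| ≤
        ∑ i ∈ Finset.range (s + 1), |a n (i + 1) - (i + 1 : ℝ) * lam i.succPNat| := by
      rw [← Finset.sum_sub_distrib]
      refine (Finset.abs_sum_le_sum_abs _ _).trans (Finset.sum_le_sum fun i _ => ?_)
      rw [← sub_mul, abs_mul, abs_of_nonneg (measureReal_nonneg (μ := P n))]
      exact mul_le_of_le_one_right (abs_nonneg _) measureReal_le_one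
    refine le_trans ?_ (add_le_add h1 h3)
    refine le_trans (le_of_eq ?_) (abs_add_le _ _)
    congr 1
    ring
  -- passage to the limit
  have hsumset : ∀ n, 1 ≤ n → ∀ R, ∑ r ∈ Finset.range R, p n r =
      (P n).real {ω | BinaryField.boxSum (X n) n 0 ω < R} := by
    intro n hn R
    rw [← measureReal_biUnion_finset]
    · congr 1
      ext ω
      simp
    · intro k _ k' _ hkk'
      refine Set.disjoint_left.2 ?_
      intro ω h1 h2
      exact hkk' (h1.symm.trans h2)
    · exact fun k _ => BinaryField.measurable_boxSum (hmeas n hn) n 0 (measurableSet_singleton k)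
  refine BinaryField.tendsto_tvDist ?_ fun j => ?_
  · filter_upwards [eventually_ge_atTop 1] with n hn
    exact Measure.isProbabilityMeasure_map
      (BinaryField.measurable_boxSum (hmeas n hn) n 0).aemeasurable
  have hconv := BinaryField.tendsto_of_recursion
    (q := fun r => (BinaryField.compoundPoisson lam).real {r})
    (BinaryField.compoundPoisson_real_zero_pos lam) hrec
    (BinaryField.compoundPoisson_recursion hlamsum) (fun _ => measureReal_nonneg)
    (BinaryField.hasSum_real_singleton _)
    (Eventually.of_forall fun n => ⟨measureReal_nonneg, measureReal_le_one⟩) (C := c) ?_ ?_ j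
  · refine hconv.congr' ?_
    filter_upwards [eventually_ge_atTop 1] with n hn
    rw [map_measureReal_apply (BinaryField.measurable_boxSum (hmeas n hn) n 0)
      (measurableSet_singleton j)]
    rfl
  · intro R
    filter_upwards [eventually_ge_atTop 1] with n hn
    rw [hsumset n hn]
    exact measureReal_le_one
  · intro R hR
    filter_upwards [eventually_ge_atTop 1] with n hn
    have hm1 : MeasurableSet {ω | BinaryField.boxSum (X n) n 0 ω < R} :=
      BinaryField.measurable_boxSum (hmeas n hn) n 0 (measurableSet_Iio (a := R))
    -- Markov's inequality with mean at most `c` gives the tail bound `c / R`, uniformly in `n`.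
    have h1 := (BinaryField.real_boxSum_ge_le (hmeas n hn) (hstat n hn) n R).trans (hi' n hn)
    have h2 : {ω | R ≤ BinaryField.boxSum (X n) n 0 ω} =
        {ω | BinaryField.boxSum (X n) n 0 ω < R}ᶜ := by
      ext ω
      simp
    rw [h2, probReal_compl_eq_one_sub hm1] at h1
    have hR' : (0 : ℝ) < R := by exact_mod_cast hR
    rw [hsumset n hn, sub_le_comm, le_div_iff₀ hR']
    linarith
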